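/- Let $n\ge 1$, let $\Omega\subset\mathbb{R}^n$ be a bounded domain (open and connected), let $f:\overline\Omega\to\mathbb{R}$ be Lipschitz continuous, and let $\varepsilon\ge 0$. For $p>n$ consider the variational integral $$J_p(v)=\int_\Omega\Bigl(\tfrac1p|\nabla v|^p-\varepsilon^{p-1}v\Bigr)\,dx$$ on the class of all $v\in C(\overline\Omega)\cap W^{1,p}(\Omega)$ with $v=f$ on $\partial\Omega$. Let $p_j>n$ with $p_j\to\infty$, let $v_{p_j}$ be the minimizer of $J_{p_j}$ in its class, and suppose that $v_{p_j}\to v_\infty$ uniformly in $\overline\Omega$. Write $\Delta_\infty\phi=\sum_{i,j=1}^n\frac{\partial\phi}{\partial x_i}\frac{\partial\phi}{\partial x_j}\frac{\partial^2\phi}{\partial x_i\partial x_j}$. A function $\phi\in C^2(\Omega)$ touches $v$ from below at $x_0\in\Omega$ if $\phi(x_0)=v(x_0)$ and $\phi(x)<v(x)$ for all $x\in\Omega\setminus\{x_0\}$; touching from above is defined with the opposite inequality. Then $v_\infty$ is a viscosity solution in $\Omega$ of $$\max\{\varepsilon-|\nabla v_\infty|,\ \Delta_\infty v_\infty\}=0,$$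 that is, $v_\infty\in C(\Omega)$, and for every $x_0\in\Omega$: (i) if $\phi\in C^2(\Omega)$ touches $v_\infty$ from below at $x_0$, then $\varepsilon\le|\nabla\phi(x_0)|$ and $\Delta_\infty\phi(x_0)\le 0$; (ii) if $\psi\in C^2(\Omega)$ touches $v_\infty$ from above at $x_0$, then $\varepsilon\ge|\nabla\psi(x_0)|$ or $\Delta_\infty\psi(x_0)\ge 0$. In the special case $\varepsilon=0$, $v_\infty$ is a viscosity solution of $\Delta_\infty v_\infty=0$ in $\Omega$: $\Delta_\infty\phi(x_0)\le0$ whenever $\phi\in C^2(\Omega)$ touches $v_\infty$ from below at $x_0$, and $\Delta_\infty\psi(x_0)\ge0$ whenever $\psi\in C^2(\Omega)$ touches $v_\infty$ from above at $x_0$. -/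

import Mathlib

open Set Filter Topology MeasureTheory
open scoped NNReal ENNReal ContDiff

noncomputable section

namespace InfinityLaplace

/-- `G` is the distributional gradient of `u` in `Ω` and both belong to `L^p(Ω)`; in particular
`u ∈ W^{1,p}(Ω)`. -/
structure HasSobolevGradient {n : ℕ} (Ω : Set (EuclideanSpace ℝ (Fin n))) (p : ℝ)
    (u : EuclideanSpace ℝ (Fin n) → ℝ)
    (G : EuclideanSpace ℝ (Fin n) → EuclideanSpace ℝ (Fin n)) : Prop where
  memLp : MemLp u (ENNReal.ofReal p) (volume.restrict Ω)
  memLp_grad : MemLp G (ENNReal.ofReal p) (volume.restrict Ω)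
  integral_eq : ∀ η : EuclideanSpace ℝ (Fin n) → ℝ, ContDiff ℝ ∞ η → HasCompactSupport η →
    tsupport η ⊆ Ω → ∀ e : EuclideanSpace ℝ (Fin n),
      ∫ x in Ω, u x * fderiv ℝ η x e = -∫ x in Ω, inner ℝ (G x) e * η x

/-- `v` belongs to `C(closure Ω) ∩ W^{1,p}(Ω)`, has the boundary values `f`, and has the
distributional gradient `G`. -/
structure IsAdmissible {n : ℕ} (Ω : Set (EuclideanSpace ℝ (Fin n)))
    (f : EuclideanSpace ℝ (Fin n) → ℝ) (p : ℝ) (v : EuclideanSpace ℝ (Fin n) → ℝ)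
    (G : EuclideanSpace ℝ (Fin n) → EuclideanSpace ℝ (Fin n)) : Prop where
  continuousOn : ContinuousOn v (closure Ω)
  boundary : ∀ x ∈ frontier Ω, v x = f x
  sobolev : HasSobolevGradient Ω p v G

/-- The integral `∫_Ω (|∇v|^p / p - ε^{p-1} v) dx`, where `G` stands for `∇v`. -/
def energy {n : ℕ} (Ω : Set (EuclideanSpace ℝ (Fin n))) (p ε : ℝ)
    (v : EuclideanSpace ℝ (Fin n) → ℝ)
    (G : EuclideanSpace ℝ (Fin n) → EuclideanSpace ℝ (Fin n)) : ℝ :=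
  ∫ x in Ω, (1 / p * ‖G x‖ ^ p - ε ^ (p - 1) * v x)

/-- `v` minimizes the energy in its class. (Distributional gradients are unique up to null sets,
so the energy of a function does not depend on the representative `G`.) -/
def IsMinimizer {n : ℕ} (Ω : Set (EuclideanSpace ℝ (Fin n)))
    (f : EuclideanSpace ℝ (Fin n) → ℝ) (p ε : ℝ) (v : EuclideanSpace ℝ (Fin n) → ℝ) : Prop :=
  ∃ G, IsAdmissible Ω f p v G ∧
    ∀ w H, IsAdmissible Ω f p w H → energy Ω p ε v G ≤ energy Ω p ε w H

/-- `Δ_∞ φ = ∑ i j, φ_i φ_j φ_ij = D²φ(∇φ, ∇φ)`. -/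
def infLaplacian {n : ℕ} (φ : EuclideanSpace ℝ (Fin n) → ℝ) (x : EuclideanSpace ℝ (Fin n)) : ℝ :=
  fderiv ℝ (fderiv ℝ φ) x (gradient φ x) (gradient φ x)

/-- `φ ∈ C²(Ω)` touches `v` strictly from below at `x₀ ∈ Ω`. -/
structure TouchesFromBelow {n : ℕ} (Ω : Set (EuclideanSpace ℝ (Fin n)))
    (φ v : EuclideanSpace ℝ (Fin n) → ℝ) (x₀ : EuclideanSpace ℝ (Fin n)) : Prop where
  mem : x₀ ∈ Ω
  contDiffOn : ContDiffOn ℝ 2 φ Ω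
  eq : φ x₀ = v x₀
  lt : ∀ x ∈ Ω, x ≠ x₀ → φ x < v x

/-- `ψ ∈ C²(Ω)` touches `v` strictly from above at `x₀ ∈ Ω`. -/
structure TouchesFromAbove {n : ℕ} (Ω : Set (EuclideanSpace ℝ (Fin n)))
    (ψ v : EuclideanSpace ℝ (Fin n) → ℝ) (x₀ : EuclideanSpace ℝ (Fin n)) : Prop where
  mem : x₀ ∈ Ω
  contDiffOn : ContDiffOn ℝ 2 ψ Ω
  eq : ψ x₀ = v x₀
  lt : ∀ x ∈ Ω, x ≠ x₀ → v x < ψ x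

/-- Viscosity supersolutions of `F v = 0` in `Ω`, where `F φ x` is the value at `x` of a
differential operator applied to `φ`. -/
def IsViscositySupersolution {n : ℕ}
    (F : (EuclideanSpace ℝ (Fin n) → ℝ) → EuclideanSpace ℝ (Fin n) → ℝ)
    (Ω : Set (EuclideanSpace ℝ (Fin n))) (v : EuclideanSpace ℝ (Fin n) → ℝ) : Prop :=
  ContinuousOn v Ω ∧ ∀ φ x₀, TouchesFromBelow Ω φ v x₀ → F φ x₀ ≤ 0

/-- Viscosity subsolutions of `F v = 0` in `Ω`. -/
def IsViscositySubsolution {n : ℕ}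
    (F : (EuclideanSpace ℝ (Fin n) → ℝ) → EuclideanSpace ℝ (Fin n) → ℝ)
    (Ω : Set (EuclideanSpace ℝ (Fin n))) (v : EuclideanSpace ℝ (Fin n) → ℝ) : Prop :=
  ContinuousOn v Ω ∧ ∀ ψ x₀, TouchesFromAbove Ω ψ v x₀ → 0 ≤ F ψ x₀

/-- Viscosity solutions of `F v = 0` in `Ω`. -/
def IsViscositySolution {n : ℕ}
    (F : (EuclideanSpace ℝ (Fin n) → ℝ) → EuclideanSpace ℝ (Fin n) → ℝ)
    (Ω : Set (EuclideanSpace ℝ (Fin n))) (v : EuclideanSpace ℝ (Fin n) → ℝ) : Prop :=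
  IsViscositySupersolution F Ω v ∧ IsViscositySubsolution F Ω v

end InfinityLaplace

end

open InfinityLaplace

/-! Formally the minimizers satisfy `Δ_p v = -ε^{p-1}`, where `Δ_p φ = |∇φ|^{p-2} tr D²φ +
(p-2)|∇φ|^{p-4} Δ_∞ φ`. For large `p` the second term dominates as long as `∇φ ≠ 0`, and the
comparison of `|∇φ|^{p-4}` with `ε^{p-4}` decides everything else. So if `|∇φ(x₀)| < ε`, or if `Δ_∞
φ(x₀) > 0`, then `Δ_p φ + ε^{p-1} > 0` on a fixed ball about `x₀` for all large `p`
(`eventually_neg_rpow_lt_pLaplacian`, `eventually_rpow_lt_pLaplacian`). It remains to see that such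
a `φ` cannot touch the limit from below (`not_eventually_strict_subsolution`).

The Euler-Lagrange equation is never derived: minimality is tested against a single competitor
(`false_of_touching`). Uniform convergence lets a raised copy of `φ` lie above `v` at `x₀` and below
it on an annulus. Let `u` be the cut-off difference `φ - v`, and let `H` be `C¹`, zero on `(-∞, 0]`,
with `h = H'` valued in `[0, 1]`. The competitor `v + H(u)` has gradient `G + h(u)(∇φ - G)`, a
pointwise convex combination of `G` and `∇φ`. Convexity of `|·|^p / p` bounds the energy change by
the integral of `h(u)|∇φ|^{p-2}⟨∇φ, ∇φ - G⟩ - c H(u)`. Integrating by parts against the `C¹` field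
`|∇φ|^{p-2}∇φ` turns this into `-∫ H(u)(Δ_p φ + c) < 0`, contradicting minimality.

Touching from above reduces to touching from below by passing to `-v`, with the constant `c =
-ε^{p-1}`. -/

lemma exists_contDiffBump_seq (E : Type*) [NormedAddCommGroup E] [NormedSpace ℝ E] :
    ∃ φ : ℕ → ContDiffBump (0 : E), Tendsto (fun k => (φ k).rOut) atTop (𝓝 0) := by
  refine ⟨fun k => ⟨1 / ((k : ℝ) + 1), 2 * (1 / ((k : ℝ) + 1)), by positivity, ?_⟩, ?_⟩
  · have : 0 < 1 / ((k : ℝ) + 1) := by positivity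
    linarith
  · simpa using (tendsto_one_div_add_atTop_nhds_zero_nat (𝕜 := ℝ)).const_mul 2

/-! ### Mollification and the chain rule for weak directional derivatives -/

section Mollification

variable {E : Type*} [NormedAddCommGroup E] [InnerProductSpace ℝ E] [FiniteDimensional ℝ E]
  [MeasurableSpace E] [BorelSpace E]

open scoped Convolution

/-- Differentiate the kernel and use the weak identity with the test function `t ↦ ρ(x - t)`; its
inner minus sign cancels the one from integration by parts. -/
lemma fderiv_normed_convolution_apply (φ : ContDiffBump (0 : E)) {u g : E → ℝ} {e : E}
    (hu : Continuous u)
    (hug : ∀ η : E → ℝ, ContDiff ℝ ∞ η → HasCompactSupport η →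
      ∫ x, u x * fderiv ℝ η x e = -∫ x, g x * η x) (x : E) :
    fderiv ℝ (φ.normed volume ⋆[ContinuousLinearMap.lsmul ℝ ℝ] u) x e
      = (φ.normed volume ⋆[ContinuousLinearMap.lsmul ℝ ℝ] g) x := by
  have hρ : ContDiff ℝ ∞ (φ.normed (volume : Measure E)) := φ.contDiff_normed
  have hρd : Differentiable ℝ (φ.normed (volume : Measure E)) := hρ.differentiable (by simp)
  have hρc : HasCompactSupport (φ.normed (volume : Measure E)) := φ.hasCompactSupport_normed
  rw [(hρc.hasFDerivAt_convolution_left (ContinuousLinearMap.lsmul ℝ ℝ)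
    (hρ.of_le (by exact_mod_cast le_top)) hu.locallyIntegrable x).fderiv]
  have hcd : Continuous fun t => fderiv ℝ (φ.normed (volume : Measure E)) (x - t) :=
    (hρ.continuous_fderiv (by simp)).comp (continuous_const.sub continuous_id)
  have hcs : HasCompactSupport fun t => fderiv ℝ (φ.normed (volume : Measure E)) (x - t) :=
    (hρc.fderiv ℝ).comp_homeomorph (Homeomorph.subLeft x)
  rw [convolution_eq_swap, convolution_eq_swap, ContinuousLinearMap.integral_apply]
  · have h := hug (fun t => φ.normed volume (x - t)) (hρ.comp (contDiff_const.sub contDiff_id))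
      (hρc.comp_homeomorph (Homeomorph.subLeft x))
    have hf : ∀ t, fderiv ℝ (fun t => φ.normed (volume : Measure E) (x - t)) t e
        = -fderiv ℝ (φ.normed volume) (x - t) e := by
      intro t
      have := (hρd (x - t)).hasFDerivAt.comp t ((hasFDerivAt_id t).const_sub x)
      have h2 : HasFDerivAt (fun t => φ.normed (volume : Measure E) (x - t)) _ t := this
      rw [h2.fderiv]
      simp
    simp only [hf, mul_neg, integral_neg, neg_inj] at h
    simp only [ContinuousLinearMap.precompL_apply, ContinuousLinearMap.lsmul_apply, smul_eq_mul]
    simp only [mul_comm (fderiv ℝ _ _ _), mul_comm (φ.normed _ _)]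
    exact h
  · refine Continuous.integrable_of_hasCompactSupport ?_ ?_
    · exact ((ContinuousLinearMap.precompL E (ContinuousLinearMap.lsmul ℝ ℝ)).continuous.comp
        hcd).clm_apply hu
    · refine hcs.mono fun t ht => ?_
      rw [Function.mem_support] at ht ⊢
      contrapose! ht
      rw [ht]; simp

/-- Fubini and the evenness of the kernel: mollification is self-adjoint. It moves the mollifier
from the merely integrable `g` to a bounded continuous factor, where pointwise convergence suffices.
-/
lemma integral_normed_convolution_mul (φ : ContDiffBump (0 : E)) {g ζ : E → ℝ}
    (hg : Integrable g) (hζ : Continuous ζ) {C : ℝ} (hC : ∀ x, ‖ζ x‖ ≤ C) :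
    ∫ x, (φ.normed volume ⋆[ContinuousLinearMap.lsmul ℝ ℝ] g) x * ζ x
      = ∫ x, g x * (φ.normed volume ⋆[ContinuousLinearMap.lsmul ℝ ℝ] ζ) x := by
  have hρc : HasCompactSupport (φ.normed (volume : Measure E)) := φ.hasCompactSupport_normed
  have hρi : Integrable (φ.normed (volume : Measure E)) :=
    φ.continuous_normed.integrable_of_hasCompactSupport hρc
  have hint := (hg.convolution_integrand (ContinuousLinearMap.mul ℝ ℝ) hρi).bdd_mul
    (f := fun q : E × E => ζ q.1) (c := C)
    (hζ.comp continuous_fst).aestronglyMeasurable (Eventually.of_forall fun q => hC q.1)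
  have h := integral_integral_swap (μ := volume) (ν := volume)
    (f := fun x y => ζ x * (ContinuousLinearMap.mul ℝ ℝ (g y) (φ.normed volume (x - y)))) hint
  simp only [ContinuousLinearMap.mul_apply'] at h
  simp only [convolution_eq_swap, ContinuousLinearMap.lsmul_apply, smul_eq_mul]
  calc _ = ∫ x, ∫ y, ζ x * (g y * φ.normed volume (x - y)) := by
        refine integral_congr_ae (Eventually.of_forall fun x => ?_)
        simp only
        rw [mul_comm, ← integral_const_mul]
        simp only [mul_comm (g _)]
    _ = _ := h
    _ = _ := by
        refine integral_congr_ae (Eventually.of_forall fun y => ?_)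
        simp only
        rw [← integral_const_mul]
        refine integral_congr_ae (Eventually.of_forall fun x => ?_)
        simp only
        rw [← φ.normed_neg (y - x), neg_sub]
        ring

lemma norm_normed_convolution_le (φ : ContDiffBump (0 : E)) {ζ : E → ℝ} {C : ℝ}
    (hC : ∀ x, ‖ζ x‖ ≤ C) (x : E) :
    ‖(φ.normed volume ⋆[ContinuousLinearMap.lsmul ℝ ℝ] ζ) x‖ ≤ C := by
  have hρi : Integrable (φ.normed (volume : Measure E)) :=
    φ.continuous_normed.integrable_of_hasCompactSupport φ.hasCompactSupport_normed
  rw [convolution_def]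
  refine (norm_integral_le_of_norm_le (hρi.mul_const C) (Eventually.of_forall fun t => ?_)).trans ?_
  · rw [ContinuousLinearMap.lsmul_apply, smul_eq_mul, norm_mul, Real.norm_eq_abs,
      abs_of_nonneg (φ.nonneg_normed t)]
    exact mul_le_mul_of_nonneg_left (hC _) (φ.nonneg_normed t)
  · rw [integral_mul_const, φ.integral_normed, one_mul]

lemma contDiff_normed_convolution (φ : ContDiffBump (0 : E)) {u : E → ℝ} (hu : Continuous u) :
    ContDiff ℝ 1 (φ.normed volume ⋆[ContinuousLinearMap.lsmul ℝ ℝ] u) := by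
  have hρ : ContDiff ℝ ((1 : ℕ∞) : WithTop ℕ∞) (φ.normed (volume : Measure E)) :=
    φ.contDiff_normed
  have := φ.hasCompactSupport_normed.contDiff_convolution_left (μ := (volume : Measure E))
    (ContinuousLinearMap.lsmul ℝ ℝ) hρ hu.locallyIntegrable
  exact_mod_cast this

/-- The limit is joint in the index and the point, because the chain rule mollifies functions that
themselves vary with the index. -/
lemma tendsto_normed_convolution {φ : ℕ → ContDiffBump (0 : E)}
    (hφ : Tendsto (fun k => (φ k).rOut) atTop (𝓝 0)) {u : E → ℝ} (hu : Continuous u) (y : E) :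
    Tendsto (fun q : ℕ × E => ((φ q.1).normed volume ⋆[ContinuousLinearMap.lsmul ℝ ℝ] u) q.2)
      (atTop ×ˢ 𝓝 y) (𝓝 (u y)) := by
  refine ContDiffBump.convolution_tendsto_right (φ := fun q : ℕ × E => φ q.1)
    (g := fun _ => u) (hφ.comp tendsto_fst)
    (Eventually.of_forall fun _ => hu.aestronglyMeasurable) ?_ tendsto_snd
  exact hu.continuousAt.tendsto.comp tendsto_snd

/-- Chain rule for the weak directional derivative `g` of `u` in the direction `e`. -/
theorem integral_comp_mul_fderiv_of_weak {u g : E → ℝ} {e : E}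
    (hu : Continuous u) (huc : HasCompactSupport u) (hg : Integrable g)
    (hug : ∀ η : E → ℝ, ContDiff ℝ ∞ η → HasCompactSupport η →
      ∫ x, u x * fderiv ℝ η x e = -∫ x, g x * η x)
    {h h' : ℝ → ℝ} (hh : ∀ t, HasDerivAt h (h' t) t) (hh' : Continuous h') {K : ℝ}
    (hK : ∀ t, ‖h' t‖ ≤ K) {η : E → ℝ} (hη : ContDiff ℝ 1 η) (hηc : HasCompactSupport η) :
    ∫ x, h (u x) * fderiv ℝ η x e = -∫ x, h' (u x) * g x * η x := by
  obtain ⟨φ, hφ⟩ := exists_contDiffBump_seq E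
  obtain ⟨U, hU⟩ : ∃ U : ℕ → E → ℝ,
      ∀ k, (φ k).normed volume ⋆[ContinuousLinearMap.lsmul ℝ ℝ] u = U k := ⟨_, fun _ => rfl⟩
  obtain ⟨M, hM⟩ := huc.exists_bound_of_continuous hu
  have hUM : ∀ k x, ‖U k x‖ ≤ M := fun k => hU k ▸ norm_normed_convolution_le (φ k) hM
  have hUs : ∀ k, ContDiff ℝ 1 (U k) :=
    fun k => hU k ▸ contDiff_normed_convolution (φ k) hu
  have hUlim : ∀ y, Tendsto (fun q : ℕ × E => U q.1 q.2) (atTop ×ˢ 𝓝 y) (𝓝 (u y)) := by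
    simpa only [hU] using tendsto_normed_convolution hφ hu
  have hUlim' : ∀ y, Tendsto (fun k => U k y) atTop (𝓝 (u y)) := by
    intro y
    have hk : Tendsto (fun k : ℕ => (k, y)) atTop (atTop ×ˢ 𝓝 y) :=
      tendsto_id.prodMk tendsto_const_nhds
    exact (hUlim y).comp hk
  have hhc : Continuous h := continuous_iff_continuousAt.2 fun t => (hh t).continuousAt
  -- `h` need not be bounded, but every mollification of `u` takes values in `[-M, M]`, so a bound
  -- for `h` there is enough.
  obtain ⟨A, hA⟩ := (isCompact_closedBall (0 : ℝ) M).exists_bound_of_continuousOn hhc.continuousOn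
  obtain ⟨B, hB⟩ := hηc.exists_bound_of_continuous hη.continuous
  have hη' : Continuous fun x => fderiv ℝ η x e :=
    (hη.continuous_fderiv one_ne_zero).clm_apply continuous_const
  have hη'c : HasCompactSupport fun x => fderiv ℝ η x e := hηc.fderiv_apply ℝ e
  let ζ : ℕ → E → ℝ := fun k x => h' (U k x) * η x
  have hζc : ∀ k, Continuous (ζ k) := fun k =>
    (hh'.comp (hUs k).continuous).mul hη.continuous
  have hζb : ∀ k x, ‖ζ k x‖ ≤ K * B := fun k x => by
    rw [norm_mul]
    exact mul_le_mul (hK _) (hB x) (norm_nonneg _) ((norm_nonneg _).trans (hK 0))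
  have hcomp : ∀ k x, HasFDerivAt (fun x => h (U k x)) (h' (U k x) • fderiv ℝ (U k) x) x :=
    fun k x => (hh _).comp_hasFDerivAt x
      ((hUs k).differentiable one_ne_zero x).hasFDerivAt
  -- The classical chain rule for the `C¹` function `h ∘ U k`, with the mollifier then transferred
  -- from `g` to `ζ k`. Both sides pass to the limit by dominated convergence.
  have key : ∀ k, ∫ x, h (U k x) * fderiv ℝ η x e
      = -∫ x, g x * ((φ k).normed volume ⋆[ContinuousLinearMap.lsmul ℝ ℝ] ζ k) x := by
    intro k
    rw [← integral_normed_convolution_mul (φ k) hg (hζc k) (hζb k),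
      integral_mul_fderiv_eq_neg_fderiv_mul_of_integrable]
    · congr 1
      refine integral_congr_ae (Eventually.of_forall fun x => ?_)
      simp only [(hcomp k x).fderiv, ← fderiv_normed_convolution_apply (φ k) hu hug x, hU, ζ]
      simp only [FunLike.coe_smul, Pi.smul_apply, smul_eq_mul]
      ring
    · refine Continuous.integrable_of_hasCompactSupport ?_ (hηc.mul_left)
      simp only [fun x => (hcomp k x).fderiv]
      exact (((hh'.comp (hUs k).continuous).smul
        ((hUs k).continuous_fderiv one_ne_zero)).clm_apply continuous_const).mul hη.continuous
    · exact ((hhc.comp (hUs k).continuous).mul hη').integrable_of_hasCompactSupport hη'c.mul_left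
    · exact ((hhc.comp (hUs k).continuous).mul
        hη.continuous).integrable_of_hasCompactSupport hηc.mul_left
    · exact fun x _ => (hcomp k x).differentiableAt
    · exact fun x _ => hη.differentiable one_ne_zero x
  have lim1 : Tendsto (fun k => ∫ x, h (U k x) * fderiv ℝ η x e) atTop
      (𝓝 (∫ x, h (u x) * fderiv ℝ η x e)) := by
    refine tendsto_integral_of_dominated_convergence (fun x => A * ‖fderiv ℝ η x e‖)
      (fun k => ((hhc.comp (hUs k).continuous).mul hη').aestronglyMeasurable)
      ((hη'.integrable_of_hasCompactSupport hη'c).norm.const_mul A)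
      (fun k => Eventually.of_forall fun x => ?_) (Eventually.of_forall fun x => ?_)
    · rw [norm_mul]
      exact mul_le_mul_of_nonneg_right (hA _ (by simpa using hUM k x)) (norm_nonneg _)
    · exact ((hhc.tendsto _).comp (hUlim' x)).mul_const _
  have lim2 : Tendsto (fun k => ∫ x, g x *
      ((φ k).normed volume ⋆[ContinuousLinearMap.lsmul ℝ ℝ] ζ k) x) atTop
      (𝓝 (∫ x, g x * (h' (u x) * η x))) := by
    refine tendsto_integral_of_dominated_convergence (fun x => ‖g x‖ * (K * B))
      (fun k => hg.aestronglyMeasurable.mul ?_) (hg.norm.mul_const _)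
      (fun k => Eventually.of_forall fun x => ?_) (Eventually.of_forall fun x => ?_)
    · exact ((φ k).hasCompactSupport_normed.continuous_convolution_left _
        (φ k).continuous_normed (hζc k).locallyIntegrable).aestronglyMeasurable
    · rw [norm_mul]
      exact mul_le_mul_of_nonneg_left (norm_normed_convolution_le (φ k) (hζb k) x) (norm_nonneg _)
    · refine Tendsto.const_mul _ (ContDiffBump.convolution_tendsto_right hφ
        (Eventually.of_forall fun k => (hζc k).aestronglyMeasurable) ?_ tendsto_const_nhds)
      exact ((hh'.tendsto _).comp (hUlim x)).mul ((hη.continuous.tendsto x).comp tendsto_snd)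
  have := tendsto_nhds_unique lim1 ((lim2.neg).congr fun k => (key k).symm)
  rw [this]
  congr 1
  exact integral_congr_ae (Eventually.of_forall fun x => by simp only; ring)

end Mollification

/-! ### A `C¹` substitute for the positive part -/

/-- The derivative of `truncPosPrimitive`. -/
noncomputable def truncPos (t : ℝ) : ℝ := max 0 (min t 1)

/-- A `C¹` nondecreasing function vanishing exactly on `(-∞, 0]`, with derivative at most `1`. -/
noncomputable def truncPosPrimitive (t : ℝ) : ℝ := ∫ s in (0 : ℝ)..t, truncPos s

lemma continuous_truncPos : Continuous truncPos := by
  unfold truncPos; fun_prop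

lemma truncPos_nonneg (t : ℝ) : 0 ≤ truncPos t := le_max_left _ _

lemma truncPos_le_one (t : ℝ) : truncPos t ≤ 1 := max_le zero_le_one (min_le_right _ _)

lemma truncPos_of_nonpos {t : ℝ} (ht : t ≤ 0) : truncPos t = 0 :=
  max_eq_left ((min_le_left _ _).trans ht)

lemma norm_truncPos_le (t : ℝ) : ‖truncPos t‖ ≤ 1 := by
  rw [Real.norm_eq_abs, abs_of_nonneg (truncPos_nonneg t)]
  exact truncPos_le_one t

lemma hasDerivAt_truncPosPrimitive (t : ℝ) : HasDerivAt truncPosPrimitive (truncPos t) t :=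
  intervalIntegral.integral_hasDerivAt_right (continuous_truncPos.intervalIntegrable _ _)
    continuous_truncPos.stronglyMeasurable.stronglyMeasurableAtFilter
    continuous_truncPos.continuousAt

lemma continuous_truncPosPrimitive : Continuous truncPosPrimitive :=
  continuous_iff_continuousAt.2 fun t => (hasDerivAt_truncPosPrimitive t).continuousAt

lemma truncPosPrimitive_of_nonpos {t : ℝ} (ht : t ≤ 0) : truncPosPrimitive t = 0 := by
  refine intervalIntegral.integral_zero_ae (Eventually.of_forall fun s hs => ?_)
  rw [uIoc_of_ge ht] at hs
  exact truncPos_of_nonpos hs.2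

lemma truncPosPrimitive_nonneg (t : ℝ) : 0 ≤ truncPosPrimitive t := by
  rcases le_total t 0 with ht | ht
  · exact (truncPosPrimitive_of_nonpos ht).ge
  · exact intervalIntegral.integral_nonneg ht fun s _ => truncPos_nonneg s

lemma truncPosPrimitive_pos {t : ℝ} (ht : 0 < t) : 0 < truncPosPrimitive t :=
  intervalIntegral.intervalIntegral_pos_of_pos_on (continuous_truncPos.intervalIntegrable _ _)
    (fun _ hs => lt_max_of_lt_right (lt_min hs.1 one_pos)) ht

/-! ### Convexity inequalities for the `p`-th power of the norm -/

section Convexity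

variable {E : Type*} [NormedAddCommGroup E] [InnerProductSpace ℝ E]

/-- Tangent inequality at `a` for the convex function `|·|^p / p`: Cauchy-Schwarz, then Young's
inequality for `|a|^{p-1}` and `|b|` with exponents `p/(p-1)` and `p`. -/
lemma norm_rpow_sub_le_inner {p : ℝ} (hp : 2 < p) (a b : E) :
    1 / p * ‖a‖ ^ p - 1 / p * ‖b‖ ^ p ≤ ‖a‖ ^ (p - 2) * inner ℝ a (a - b) := by
  have hp0 : 0 < p := by linarith
  have hq : (p / (p - 1)).HolderConjugate p :=
    (Real.HolderConjugate.conjExponent (by linarith : 1 < p)).symm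
  have hy := Real.young_inequality_of_nonneg (a := ‖a‖ ^ (p - 1)) (b := ‖b‖)
    (by positivity) (norm_nonneg b) hq
  rw [← Real.rpow_mul (norm_nonneg a), mul_div_cancel₀ _ (by linarith : p - 1 ≠ 0)] at hy
  have h1 : ‖a‖ ^ (p - 1) = ‖a‖ ^ (p - 2) * ‖a‖ := by
    rcases (norm_nonneg a).eq_or_lt with h | h
    · rw [← h, Real.zero_rpow (by linarith), mul_zero]
    · rw [← Real.rpow_add_one h.ne']; congr 1; ring
  have h2 : ‖a‖ ^ p = ‖a‖ ^ (p - 2) * ‖a‖ ^ 2 := by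
    rcases (norm_nonneg a).eq_or_lt with h | h
    · rw [← h, Real.zero_rpow (by linarith)]; simp
    · rw [← Real.rpow_natCast, ← Real.rpow_add h]; congr 1; norm_num
  have h3 : ‖a‖ ^ (p - 2) * inner ℝ a b ≤ ‖a‖ ^ (p - 1) * ‖b‖ := by
    rw [h1, mul_assoc]
    exact mul_le_mul_of_nonneg_left (real_inner_le_norm a b) (by positivity)
  rw [inner_sub_right, real_inner_self_eq_norm_sq, mul_sub, ← h2]
  have h4 : ‖a‖ ^ p / (p / (p - 1)) = ‖a‖ ^ p - 1 / p * ‖a‖ ^ p := by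
    field_simp
  rw [h4] at hy
  have h5 : ‖b‖ ^ p / p = 1 / p * ‖b‖ ^ p := by ring
  linarith

/-- Convexity along the segment from `b` to `a`, followed by the tangent inequality at `a`. The
nonlinear factor is evaluated at `a` only: with `a` the gradient of the smooth function, the flux to
be integrated by parts is `C¹`. -/
lemma norm_rpow_combination_sub_le {p : ℝ} (hp : 2 < p) (a b : E) {t : ℝ} (ht0 : 0 ≤ t)
    (ht1 : t ≤ 1) :
    1 / p * ‖b + t • (a - b)‖ ^ p - 1 / p * ‖b‖ ^ p
      ≤ t * (‖a‖ ^ (p - 2) * inner ℝ a (a - b)) := by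
  have hp0 : 0 < p := by linarith
  have h1 : ‖b + t • (a - b)‖ ≤ (1 - t) * ‖b‖ + t * ‖a‖ := by
    have : b + t • (a - b) = (1 - t) • b + t • a := by
      rw [smul_sub, sub_smul, one_smul]; abel
    rw [this]
    refine (norm_add_le _ _).trans_eq ?_
    rw [norm_smul, norm_smul, Real.norm_eq_abs, Real.norm_eq_abs, abs_of_nonneg ht0,
      abs_of_nonneg (sub_nonneg.2 ht1)]
  have h2 := (convexOn_rpow (by linarith : 1 ≤ p)).2 (mem_Ici.2 (norm_nonneg b))
    (mem_Ici.2 (norm_nonneg a)) (sub_nonneg.2 ht1) ht0 (by ring)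
  simp only [smul_eq_mul] at h2
  have h3 := (Real.rpow_le_rpow (norm_nonneg _) h1 hp0.le).trans h2
  have h4 := mul_le_mul_of_nonneg_left h3 (by positivity : 0 ≤ 1 / p)
  have h5 := mul_le_mul_of_nonneg_left (norm_rpow_sub_le_inner hp a b) ht0
  linarith

end Convexity

/-! ### The `p`-Laplacian of a `C²` function as a divergence -/

section PLaplacian

variable {n : ℕ}

/-- The trace of the Hessian. -/
noncomputable def hessianTrace (φ : EuclideanSpace ℝ (Fin n) → ℝ) (x : EuclideanSpace ℝ (Fin n)) : ℝ :=
  ∑ i, fderiv ℝ (fderiv ℝ φ) x (EuclideanSpace.basisFun (Fin n) ℝ i)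
    (EuclideanSpace.basisFun (Fin n) ℝ i)

/-- The `p`-Laplacian `div (|∇φ|^{p-2} ∇φ)` in nondivergence form. -/
noncomputable def pLaplacian (p : ℝ) (φ : EuclideanSpace ℝ (Fin n) → ℝ) (x : EuclideanSpace ℝ (Fin n)) : ℝ :=
  ‖gradient φ x‖ ^ (p - 2) * hessianTrace φ x
    + (p - 2) * ‖gradient φ x‖ ^ (p - 4) * infLaplacian φ x

/-- The `i`-th component of `|∇φ|^{p-2} ∇φ`. -/
noncomputable def pFlux (p : ℝ) (φ : EuclideanSpace ℝ (Fin n) → ℝ) (i : Fin n)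
    (x : EuclideanSpace ℝ (Fin n)) : ℝ :=
  ‖gradient φ x‖ ^ (p - 2) * inner ℝ (gradient φ x) (EuclideanSpace.basisFun (Fin n) ℝ i)

variable {φ ψ : EuclideanSpace ℝ (Fin n) → ℝ} {x : EuclideanSpace ℝ (Fin n)} {p : ℝ}

lemma gradient_congr_nhds (h : φ =ᶠ[𝓝 x] ψ) : gradient φ x = gradient ψ x := by
  rw [gradient, gradient, h.fderiv_eq]

lemma infLaplacian_congr (h : φ =ᶠ[𝓝 x] ψ) : infLaplacian φ x = infLaplacian ψ x := by
  rw [infLaplacian, infLaplacian, h.fderiv.fderiv_eq, gradient_congr_nhds h]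

lemma hessianTrace_congr (h : φ =ᶠ[𝓝 x] ψ) : hessianTrace φ x = hessianTrace ψ x := by
  rw [hessianTrace, hessianTrace, h.fderiv.fderiv_eq]

lemma pLaplacian_congr (h : φ =ᶠ[𝓝 x] ψ) : pLaplacian p φ x = pLaplacian p ψ x := by
  rw [pLaplacian, pLaplacian, gradient_congr_nhds h, infLaplacian_congr h, hessianTrace_congr h]

lemma contDiff_gradient (hφ : ContDiff ℝ 2 φ) : ContDiff ℝ 1 (gradient φ) :=
  (InnerProductSpace.toDual ℝ (EuclideanSpace ℝ (Fin n))).symm.contDiff.comp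
    (hφ.fderiv_right (m := 1) (by norm_num))

lemma inner_gradient (v : EuclideanSpace ℝ (Fin n)) :
    inner ℝ (gradient φ x) v = fderiv ℝ φ x v := by
  rw [gradient, InnerProductSpace.toDual_symm_apply]

lemma contDiff_pFlux (hp : 4 < p) (hφ : ContDiff ℝ 2 φ) (i : Fin n) :
    ContDiff ℝ 1 (pFlux p φ i) :=
  ((contDiff_norm_rpow (by linarith : 1 < p - 2)).comp (contDiff_gradient hφ)).mul
    ((contDiff_gradient hφ).inner ℝ contDiff_const)

lemma hasCompactSupport_gradient (hφ : HasCompactSupport φ) : HasCompactSupport (gradient φ) :=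
  (hφ.fderiv ℝ).comp_left (map_zero (InnerProductSpace.toDual ℝ _).symm)

lemma hasCompactSupport_pFlux (hφ : HasCompactSupport φ) (i : Fin n) :
    HasCompactSupport (pFlux p φ i) :=
  (hasCompactSupport_gradient hφ).mono fun x hx => by
    rw [Function.mem_support] at hx ⊢
    contrapose! hx
    simp [pFlux, hx]

/-- Product and chain rules. Since `p - 2 > 1`, the function `|ξ|^{p-2}` is `C¹` at the origin too,
so critical points of `φ` need no separate treatment. -/
lemma fderiv_pFlux (hp : 4 < p) (hφ : ContDiff ℝ 2 φ) (i : Fin n)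
    (x e : EuclideanSpace ℝ (Fin n)) :
    fderiv ℝ (pFlux p φ i) x e
      = ‖gradient φ x‖ ^ (p - 2) *
          fderiv ℝ (fderiv ℝ φ) x e (EuclideanSpace.basisFun (Fin n) ℝ i)
        + (p - 2) * ‖gradient φ x‖ ^ (p - 4) * fderiv ℝ (fderiv ℝ φ) x e (gradient φ x)
          * inner ℝ (gradient φ x) (EuclideanSpace.basisFun (Fin n) ℝ i) := by
  have hd : HasFDerivAt (fderiv ℝ φ) (fderiv ℝ (fderiv ℝ φ) x) x :=
    ((hφ.fderiv_right (m := 1) (by norm_num)).differentiable one_ne_zero x).hasFDerivAt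
  have hg : HasFDerivAt (gradient φ) (fderiv ℝ (gradient φ) x) x :=
    ((contDiff_gradient hφ).differentiable one_ne_zero x).hasFDerivAt
  have hge : ∀ v, inner ℝ (fderiv ℝ (gradient φ) x e) v = fderiv ℝ (fderiv ℝ φ) x e v := by
    intro v
    have h1 : HasFDerivAt (fun y => inner ℝ (gradient φ y) v) _ x :=
      hg.inner ℝ (hasFDerivAt_const v x)
    have h2 : HasFDerivAt (fun y => fderiv ℝ φ y v) _ x := hd.clm_apply (hasFDerivAt_const v x)
    simp only [inner_gradient] at h1
    have h3 := DFunLike.congr_fun (h1.unique h2) e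
    simpa using h3
  have h1 : HasFDerivAt (fun y => ‖gradient φ y‖ ^ (p - 2)) _ x :=
    (hasFDerivAt_norm_rpow (gradient φ x) (by linarith : 1 < p - 2)).comp x hg
  have h2 : HasFDerivAt
      (fun y => inner ℝ (gradient φ y) (EuclideanSpace.basisFun (Fin n) ℝ i)) _ x :=
    hg.inner ℝ (hasFDerivAt_const _ x)
  have h3 : HasFDerivAt (pFlux p φ i) _ x := h1.mul h2
  rw [h3.fderiv]
  have h4 : fderiv ℝ φ x (fderiv ℝ (gradient φ) x e)
      = fderiv ℝ (fderiv ℝ φ) x e (gradient φ x) := by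
    rw [← inner_gradient, real_inner_comm, hge]
  simp [hge, h4, show p - 2 - 2 = p - 4 by ring]
  ring

lemma sum_fderiv_pFlux (hp : 4 < p) (hφ : ContDiff ℝ 2 φ) (x : EuclideanSpace ℝ (Fin n)) :
    ∑ i, fderiv ℝ (pFlux p φ i) x (EuclideanSpace.basisFun (Fin n) ℝ i) = pLaplacian p φ x := by
  have h : infLaplacian φ x = ∑ i, fderiv ℝ (fderiv ℝ φ) x
      (EuclideanSpace.basisFun (Fin n) ℝ i) (gradient φ x)
        * inner ℝ (gradient φ x) (EuclideanSpace.basisFun (Fin n) ℝ i) := by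
    rw [infLaplacian]
    conv_lhs => enter [1, 2]; rw [← (EuclideanSpace.basisFun (Fin n) ℝ).sum_repr (gradient φ x)]
    rw [map_sum, sum_apply]
    refine Finset.sum_congr rfl fun i _ => ?_
    rw [map_smul, smul_apply, smul_eq_mul, mul_comm, OrthonormalBasis.repr_apply_apply,
      real_inner_comm]
  simp only [fderiv_pFlux hp hφ, Finset.sum_add_distrib, pLaplacian, h, hessianTrace,
    Finset.mul_sum, mul_assoc]

end PLaplacian

/-! ### Localizing a Sobolev function by a cut-off -/

section Comparison

variable {n : ℕ} {Ω : Set (EuclideanSpace ℝ (Fin n))}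

lemma continuous_mul_of_tsupport_subset {X : Type*} [TopologicalSpace X] {U : Set X} {a b : X → ℝ}
    (hU : IsOpen U) (ha : Continuous a) (hsupp : tsupport a ⊆ U) (hb : ContinuousOn b U) :
    Continuous fun x => a x * b x := by
  refine continuous_iff_continuousAt.2 fun x => ?_
  by_cases hx : x ∈ U
  · exact ha.continuousAt.mul (hb.continuousAt (hU.mem_nhds hx))
  · have h0 : a =ᶠ[𝓝 x] 0 := notMem_tsupport_iff_eventuallyEq.1 fun h => hx (hsupp h)
    refine (continuousAt_const (y := (0 : ℝ))).congr ?_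
    filter_upwards [h0] with y hy
    simp [hy]

lemma contDiff_mul_of_tsupport_subset {E : Type*} [NormedAddCommGroup E] [NormedSpace ℝ E]
    {U : Set E} {a b : E → ℝ} {k : WithTop ℕ∞} (hU : IsOpen U) (ha : ContDiff ℝ k a)
    (hsupp : tsupport a ⊆ U) (hb : ContDiffOn ℝ k b U) :
    ContDiff ℝ k fun x => a x * b x := by
  refine contDiff_iff_contDiffAt.2 fun x => ?_
  by_cases hx : x ∈ U
  · exact ha.contDiffAt.mul (hb.contDiffAt (hU.mem_nhds hx))
  · have h0 : a =ᶠ[𝓝 x] 0 := notMem_tsupport_iff_eventuallyEq.1 fun h => hx (hsupp h)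
    refine (contDiffAt_const (c := (0 : ℝ))).congr_of_eventuallyEq ?_
    filter_upwards [h0] with y hy
    simp [hy]

variable {v χ : EuclideanSpace ℝ (Fin n) → ℝ}
  {G : EuclideanSpace ℝ (Fin n) → EuclideanSpace ℝ (Fin n)} {p : ℝ}

lemma integrable_of_eqOn_zero_compl {X : Type*} [MeasurableSpace X] {μ : Measure X} {s : Set X}
    (hs : MeasurableSet s) {g : X → ℝ} (hg : IntegrableOn g s μ) (h0 : ∀ x ∉ s, g x = 0) :
    Integrable g μ := by
  rw [← integrable_indicator_iff hs] at hg
  refine hg.congr (Eventually.of_forall fun x => ?_)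
  by_cases hx : x ∈ s
  · simp [hx]
  · simp [hx, h0 x hx]

/-- A cut-off of a Sobolev function has a weak derivative on the whole space. -/
lemma InfinityLaplace.HasSobolevGradient.cutoff (hS : HasSobolevGradient Ω p v G) (hΩ : IsOpen Ω)
    (hΩf : volume Ω ≠ ⊤) (hp : 1 ≤ p) (hv : ContinuousOn v Ω) (hχ : ContDiff ℝ ∞ χ)
    (hχc : HasCompactSupport χ) (hχΩ : tsupport χ ⊆ Ω) (e : EuclideanSpace ℝ (Fin n)) :
    Integrable (fun x => χ x * inner ℝ (G x) e + v x * fderiv ℝ χ x e) ∧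
    ∀ η : EuclideanSpace ℝ (Fin n) → ℝ, ContDiff ℝ ∞ η →
      ∫ x, (χ x * v x) * fderiv ℝ η x e
        = -∫ x, (χ x * inner ℝ (G x) e + v x * fderiv ℝ χ x e) * η x := by
  have : IsFiniteMeasure (volume.restrict Ω) := ⟨by simpa using hΩf.lt_top⟩
  have hp1 : (1 : ℝ≥0∞) ≤ ENNReal.ofReal p := by simpa using hp
  have hGi : IntegrableOn G Ω := hS.memLp_grad.integrable hp1
  have hGe : IntegrableOn (fun x => inner ℝ (G x) e) Ω := hGi.inner_const e
  have hχ0 : ∀ x ∉ Ω, χ x = 0 := fun x hx => image_eq_zero_of_notMem_tsupport fun h => hx (hχΩ h)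
  have hχd0 : ∀ x ∉ Ω, fderiv ℝ χ x e = 0 := fun x hx => by
    rw [image_eq_zero_of_notMem_tsupport (f := fderiv ℝ χ)
      fun h => hx (hχΩ (tsupport_fderiv_subset ℝ h))]
    rfl
  have hχdc : Continuous fun x => fderiv ℝ χ x e :=
    (hχ.continuous_fderiv (by simp)).clm_apply continuous_const
  have hχdcs : HasCompactSupport fun x => fderiv ℝ χ x e := hχc.fderiv_apply ℝ e
  have hvd : Continuous fun x => fderiv ℝ χ x e * v x :=
    continuous_mul_of_tsupport_subset hΩ hχdc ((tsupport_fderiv_apply_subset ℝ e).trans hχΩ) hv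
  have hχv : Continuous fun x => χ x * v x :=
    continuous_mul_of_tsupport_subset hΩ hχ.continuous hχΩ hv
  obtain ⟨C, hC⟩ := hχc.exists_bound_of_continuous hχ.continuous
  have hint1 : Integrable fun x => χ x * inner ℝ (G x) e :=
    integrable_of_eqOn_zero_compl hΩ.measurableSet
      (hGe.bdd_mul hχ.continuous.aestronglyMeasurable (Eventually.of_forall hC))
      fun x hx => by simp [hχ0 x hx]
  have hint2 : Integrable fun x => v x * fderiv ℝ χ x e := by
    simp only [mul_comm (v _)]
    exact hvd.integrable_of_hasCompactSupport hχdcs.mul_right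
  refine ⟨hint1.add hint2, fun η hη => ?_⟩
  have hprod : ∀ x, fderiv ℝ (fun y => χ y * η y) x e
      = χ x * fderiv ℝ η x e + η x * fderiv ℝ χ x e := fun x => by
    have h : HasFDerivAt (fun y => χ y * η y) _ x :=
      (hχ.differentiable (by simp) x).hasFDerivAt.mul (hη.differentiable (by simp) x).hasFDerivAt
    rw [h.fderiv]; simp
  -- Testing with `χ η`, which is supported in `Ω`, frees `η` of any support condition; the product
  -- rule produces the extra term `v ∂ₑχ`.
  have hw := hS.integral_eq (fun y => χ y * η y) (hχ.mul hη) hχc.mul_right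
    ((tsupport_mul_subset_left (f := χ) (g := η)).trans hχΩ) e
  simp only [hprod] at hw
  have hη' : Continuous fun x => fderiv ℝ η x e :=
    (hη.continuous_fderiv (by simp)).clm_apply continuous_const
  have hA : Integrable fun x => (χ x * v x) * fderiv ℝ η x e :=
    (hχv.mul hη').integrable_of_hasCompactSupport hχc.mul_right.mul_right
  have hB : Integrable fun x => (fderiv ℝ χ x e * v x) * η x :=
    (hvd.mul hη.continuous).integrable_of_hasCompactSupport hχdcs.mul_right.mul_right
  have hD : Integrable fun x => (χ x * inner ℝ (G x) e) * η x := by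
    obtain ⟨C', hC'⟩ := (hχc.mul_right (f' := η)).exists_bound_of_continuous
      (hχ.continuous.mul hη.continuous)
    have h := integrable_of_eqOn_zero_compl hΩ.measurableSet
      (hGe.bdd_mul (hχ.continuous.mul hη.continuous).aestronglyMeasurable (Eventually.of_forall hC'))
      fun x hx => by simp [hχ0 x hx]
    exact h.congr (Eventually.of_forall fun x => by simp only [Pi.mul_apply]; ring)
  rw [setIntegral_eq_integral_of_forall_compl_eq_zero
      (fun x hx => by rw [hχ0 x hx, hχd0 x hx]; ring),
    setIntegral_eq_integral_of_forall_compl_eq_zero (fun x hx => by rw [hχ0 x hx]; ring)] at hw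
  have e1 : ∫ x, v x * (χ x * fderiv ℝ η x e + η x * fderiv ℝ χ x e)
      = (∫ x, (χ x * v x) * fderiv ℝ η x e) + ∫ x, (fderiv ℝ χ x e * v x) * η x := by
    rw [← integral_add hA hB]
    exact integral_congr_ae (Eventually.of_forall fun x => by simp only; ring)
  have e2 : ∫ x, (χ x * inner ℝ (G x) e + v x * fderiv ℝ χ x e) * η x
      = (∫ x, (χ x * inner ℝ (G x) e) * η x) + ∫ x, (fderiv ℝ χ x e * v x) * η x := by
    rw [← integral_add hD hB]
    exact integral_congr_ae (Eventually.of_forall fun x => by simp only; ring)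
  have e3 : ∫ x, inner ℝ (G x) e * (χ x * η x) = ∫ x, (χ x * inner ℝ (G x) e) * η x :=
    integral_congr_ae (Eventually.of_forall fun x => by simp only; ring)
  rw [e1, e3] at hw
  rw [e2]
  linarith

end Comparison

/-! ### The competitor and the contradiction with minimality -/

section Comparison

variable {n : ℕ} {Ω : Set (EuclideanSpace ℝ (Fin n))}
  {v χ φ f : EuclideanSpace ℝ (Fin n) → ℝ}
  {G : EuclideanSpace ℝ (Fin n) → EuclideanSpace ℝ (Fin n)} {p : ℝ}

/-- Weak derivative of the truncated positive part of `φ - v`, when that difference is positive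
on the support of the cut-off `χ` only where `χ = 1`. -/
lemma InfinityLaplace.HasSobolevGradient.truncPos_cutoff (hS : HasSobolevGradient Ω p v G)
    (hΩ : IsOpen Ω) (hΩf : volume Ω ≠ ⊤) (hp : 1 ≤ p) (hv : ContinuousOn v Ω)
    (hχ : ContDiff ℝ ∞ χ) (hχc : HasCompactSupport χ) (hχΩ : tsupport χ ⊆ Ω)
    (hφ : ContDiffOn ℝ 2 φ Ω) (hone : ∀ x, 0 < χ x * (φ x - v x) → χ =ᶠ[𝓝 x] 1)
    (e : EuclideanSpace ℝ (Fin n)) :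
    Integrable (fun x => truncPos (χ x * (φ x - v x)) *
      inner ℝ (gradient (fun y => χ y * φ y) x - G x) e) ∧
    ∀ η : EuclideanSpace ℝ (Fin n) → ℝ, ContDiff ℝ 1 η → HasCompactSupport η →
      ∫ x, truncPosPrimitive (χ x * (φ x - v x)) * fderiv ℝ η x e
        = -∫ x, truncPos (χ x * (φ x - v x)) *
            inner ℝ (gradient (fun y => χ y * φ y) x - G x) e * η x := by
  obtain ⟨hgi, hgw⟩ := hS.cutoff hΩ hΩf hp hv hχ hχc hχΩ e
  have hΦ : ContDiff ℝ 2 fun y => χ y * φ y :=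
    contDiff_mul_of_tsupport_subset hΩ (mod_cast contDiff_infty.1 hχ 2) hχΩ hφ
  have hΦc : HasCompactSupport fun y => χ y * φ y := hχc.mul_right
  have hχv : Continuous fun x => χ x * v x :=
    continuous_mul_of_tsupport_subset hΩ hχ.continuous hχΩ hv
  have hu : Continuous fun x => χ x * (φ x - v x) := by
    simp only [mul_sub]; exact hΦ.continuous.sub hχv
  have huc : HasCompactSupport fun x => χ x * (φ x - v x) := hχc.mul_right
  have hΦd : Continuous fun x => fderiv ℝ (fun y => χ y * φ y) x e :=
    (hΦ.continuous_fderiv (by simp)).clm_apply continuous_const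
  have hΦdi : Integrable fun x => fderiv ℝ (fun y => χ y * φ y) x e :=
    hΦd.integrable_of_hasCompactSupport (hΦc.fderiv_apply ℝ e)
  have hw : ∀ η : EuclideanSpace ℝ (Fin n) → ℝ, ContDiff ℝ ∞ η → HasCompactSupport η →
      ∫ x, (χ x * (φ x - v x)) * fderiv ℝ η x e
        = -∫ x, (fderiv ℝ (fun y => χ y * φ y) x e
            - (χ x * inner ℝ (G x) e + v x * fderiv ℝ χ x e)) * η x := by
    intro η hη hηc
    have hη' : Continuous fun x => fderiv ℝ η x e :=
      (hη.continuous_fderiv (by simp)).clm_apply continuous_const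
    obtain ⟨C, hC⟩ := hηc.exists_bound_of_continuous hη.continuous
    have i1 : Integrable fun x => fderiv ℝ (fun y => χ y * φ y) x e * η x :=
      (hΦd.mul hη.continuous).integrable_of_hasCompactSupport hηc.mul_left
    have i2 : Integrable fun x => (χ x * φ x) * fderiv ℝ η x e :=
      (hΦ.continuous.mul hη').integrable_of_hasCompactSupport hΦc.mul_right
    have i3 : Integrable fun x => (χ x * v x) * fderiv ℝ η x e :=
      (hχv.mul hη').integrable_of_hasCompactSupport hχc.mul_right.mul_right
    have i4 : Integrable fun x => (χ x * inner ℝ (G x) e + v x * fderiv ℝ χ x e) * η x := by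
      simp only [mul_comm _ (η _)]
      exact hgi.bdd_mul hη.continuous.aestronglyMeasurable (Eventually.of_forall hC)
    have hibp := integral_mul_fderiv_eq_neg_fderiv_mul_of_integrable i1 i2
      ((hΦ.continuous.mul hη.continuous).integrable_of_hasCompactSupport hηc.mul_left)
      (fun x _ => hΦ.differentiable (by simp) x) (fun x _ => hη.differentiable (by simp) x)
    simp only [mul_sub, sub_mul]
    rw [integral_sub i2 i3, integral_sub i1 i4, hibp, hgw η hη]
    ring
  -- Where `u ≤ 0` the factor `truncPos u` vanishes; where `u > 0` the cut-off is locally `1`, so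
  -- the terms with `∇χ` disappear and only `∇φ - G` remains.
  have hpt : ∀ x, truncPos (χ x * (φ x - v x)) *
      (fderiv ℝ (fun y => χ y * φ y) x e - (χ x * inner ℝ (G x) e + v x * fderiv ℝ χ x e))
      = truncPos (χ x * (φ x - v x)) *
        inner ℝ (gradient (fun y => χ y * φ y) x - G x) e := by
    intro x
    rcases le_or_gt (χ x * (φ x - v x)) 0 with h | h
    · rw [truncPos_of_nonpos h, zero_mul, zero_mul]
    · have h1 := hone x h
      have h2 : fderiv ℝ χ x = 0 := by
        rw [h1.fderiv_eq]; exact fderiv_const_apply 1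
      rw [inner_sub_left, inner_gradient, h1.eq_of_nhds, h2]
      simp
  have hGi := hΦdi.sub hgi
  constructor
  · have := hGi.bdd_mul (f := fun x => truncPos (χ x * (φ x - v x)))
      (continuous_truncPos.comp hu).aestronglyMeasurable
      (Eventually.of_forall fun x => norm_truncPos_le _)
    exact this.congr (Eventually.of_forall hpt)
  · intro η hη hηc
    rw [integral_comp_mul_fderiv_of_weak hu huc hGi hw hasDerivAt_truncPosPrimitive
      continuous_truncPos norm_truncPos_le hη hηc]
    congr 1
    exact integral_congr_ae (Eventually.of_forall fun x => congrArg (· * η x) (hpt x))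

/-- Replacing `v` by `v + h(φ - v)` near a point keeps it admissible. -/
lemma InfinityLaplace.IsAdmissible.add_truncPos (hA : IsAdmissible Ω f p v G)
    (hΩ : IsOpen Ω) (hΩf : volume Ω ≠ ⊤) (hp : 1 ≤ p)
    (hχ : ContDiff ℝ ∞ χ) (hχc : HasCompactSupport χ) (hχΩ : tsupport χ ⊆ Ω)
    (hφ : ContDiffOn ℝ 2 φ Ω) (hone : ∀ x, 0 < χ x * (φ x - v x) → χ =ᶠ[𝓝 x] 1) :
    IsAdmissible Ω f p (fun x => v x + truncPosPrimitive (χ x * (φ x - v x)))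
      (fun x => G x + truncPos (χ x * (φ x - v x)) •
        (gradient (fun y => χ y * φ y) x - G x)) := by
  have hv : ContinuousOn v Ω := hA.continuousOn.mono subset_closure
  have hΦ : ContDiff ℝ 2 fun y => χ y * φ y :=
    contDiff_mul_of_tsupport_subset hΩ (mod_cast contDiff_infty.1 hχ 2) hχΩ hφ
  have hΦc : HasCompactSupport fun y => χ y * φ y := hχc.mul_right
  have hχ0 : ∀ x ∉ Ω, χ x = 0 := fun x hx => image_eq_zero_of_notMem_tsupport fun h => hx (hχΩ h)
  have hu : Continuous fun x => χ x * (φ x - v x) :=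
    continuous_mul_of_tsupport_subset hΩ hχ.continuous hχΩ (hφ.continuousOn.sub hv)
  have huc : HasCompactSupport fun x => χ x * (φ x - v x) := hχc.mul_right
  have hhu : Continuous fun x => truncPosPrimitive (χ x * (φ x - v x)) :=
    continuous_truncPosPrimitive.comp hu
  have hhuc : HasCompactSupport fun x => truncPosPrimitive (χ x * (φ x - v x)) :=
    huc.comp_left (truncPosPrimitive_of_nonpos le_rfl)
  have hgc : Continuous (gradient fun y => χ y * φ y) := (contDiff_gradient hΦ).continuous
  have hgcs : HasCompactSupport (gradient fun y => χ y * φ y) := hasCompactSupport_gradient hΦc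
  have hgL : MemLp (gradient fun y => χ y * φ y) (ENNReal.ofReal p) (volume.restrict Ω) :=
    (hgc.memLp_of_hasCompactSupport hgcs).restrict _
  refine ⟨hA.continuousOn.add hhu.continuousOn, fun x hx => ?_, ?_, ?_, ?_⟩
  · have hxΩ : x ∉ Ω := (hΩ.frontier_eq ▸ hx).2
    rw [hχ0 x hxΩ, zero_mul, truncPosPrimitive_of_nonpos le_rfl, add_zero, hA.boundary x hx]
  · exact hA.sobolev.memLp.add ((hhu.memLp_of_hasCompactSupport hhuc).restrict _)
  · have hd := hgL.sub hA.sobolev.memLp_grad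
    refine hA.sobolev.memLp_grad.add (hd.mono ?_ (Eventually.of_forall fun x => ?_))
    · exact (continuous_truncPos.comp hu).aestronglyMeasurable.smul hd.aestronglyMeasurable
    · rw [norm_smul]
      exact mul_le_of_le_one_left (norm_nonneg _) (norm_truncPos_le _)
  · intro η hη hηc hηΩ e
    obtain ⟨hi, hw⟩ := hA.sobolev.truncPos_cutoff hΩ hΩf hp hv hχ hχc hχΩ hφ hone e
    have : IsFiniteMeasure (volume.restrict Ω) := ⟨by simpa using hΩf.lt_top⟩
    have hp1 : (1 : ℝ≥0∞) ≤ ENNReal.ofReal p := by simpa using hp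
    have hη' : Continuous fun x => fderiv ℝ η x e :=
      (hη.continuous_fderiv (by simp)).clm_apply continuous_const
    obtain ⟨C, hC⟩ := hηc.exists_bound_of_continuous hη.continuous
    obtain ⟨C', hC'⟩ := (hηc.fderiv_apply ℝ e).exists_bound_of_continuous hη'
    have i1 : IntegrableOn (fun x => v x * fderiv ℝ η x e) Ω := by
      simp only [mul_comm (v _)]
      exact (hA.sobolev.memLp.integrable hp1).bdd_mul hη'.aestronglyMeasurable
        (Eventually.of_forall hC')
    have i2 : Integrable fun x => truncPosPrimitive (χ x * (φ x - v x)) * fderiv ℝ η x e :=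
      (hhu.mul hη').integrable_of_hasCompactSupport hhuc.mul_right
    have i3 : IntegrableOn (fun x => inner ℝ (G x) e * η x) Ω := by
      simp only [mul_comm _ (η _)]
      exact ((hA.sobolev.memLp_grad.integrable hp1).inner_const e).bdd_mul
        hη.continuous.aestronglyMeasurable (Eventually.of_forall hC)
    have i4 : Integrable fun x => truncPos (χ x * (φ x - v x)) *
        inner ℝ (gradient (fun y => χ y * φ y) x - G x) e * η x := by
      simp only [mul_comm _ (η _)]
      exact hi.bdd_mul hη.continuous.aestronglyMeasurable (Eventually.of_forall hC)
    have h1 := hw η (hη.of_le (by exact_mod_cast le_top)) hηc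
    have s1 : ∫ x in Ω, truncPosPrimitive (χ x * (φ x - v x)) * fderiv ℝ η x e
        = ∫ x, truncPosPrimitive (χ x * (φ x - v x)) * fderiv ℝ η x e :=
      setIntegral_eq_integral_of_forall_compl_eq_zero fun x hx => by
        rw [hχ0 x hx, zero_mul, truncPosPrimitive_of_nonpos le_rfl, zero_mul]
    have s2 : ∫ x in Ω, truncPos (χ x * (φ x - v x)) *
          inner ℝ (gradient (fun y => χ y * φ y) x - G x) e * η x
        = ∫ x, truncPos (χ x * (φ x - v x)) *
          inner ℝ (gradient (fun y => χ y * φ y) x - G x) e * η x :=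
      setIntegral_eq_integral_of_forall_compl_eq_zero fun x hx => by
        rw [hχ0 x hx, zero_mul, truncPos_of_nonpos le_rfl, zero_mul, zero_mul]
    simp only [inner_add_left, inner_smul_left, add_mul, RCLike.conj_to_real]
    rw [integral_add i1 i2.integrableOn, integral_add i3 i4.integrableOn, s1, s2, h1,
      hA.sobolev.integral_eq η hη hηc hηΩ e]
    ring

/-- A minimizer cannot lie below a strict subsolution `φ` at a point and above it on a surrounding
annulus. -/
theorem InfinityLaplace.IsAdmissible.false_of_touching (hA : IsAdmissible Ω f p v G)
    (hΩ : IsOpen Ω) (hΩf : volume Ω ≠ ⊤) (hp : 4 < p) {c : ℝ}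
    (hmin : ∀ w H, IsAdmissible Ω f p w H →
      ∫ x in Ω, (1 / p * ‖G x‖ ^ p - c * v x) ≤ ∫ x in Ω, (1 / p * ‖H x‖ ^ p - c * w x))
    (hφ : ContDiffOn ℝ 2 φ Ω) {x₀ : EuclideanSpace ℝ (Fin n)} {r R : ℝ} (hr : 0 < r) (hrR : r < R)
    (hball : Metric.closedBall x₀ R ⊆ Ω) (hx₀ : v x₀ < φ x₀)
    (hann : ∀ x ∈ Metric.closedBall x₀ R, r ≤ dist x x₀ → φ x ≤ v x)
    (hpos : ∀ x ∈ Metric.ball x₀ r, 0 < pLaplacian p φ x + c) : False := by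
  let b : ContDiffBump x₀ := ⟨r, R, hr, hrR⟩
  obtain ⟨χ, hχdef⟩ : ∃ χ : EuclideanSpace ℝ (Fin n) → ℝ, χ = b := ⟨_, rfl⟩
  have hχ : ContDiff ℝ ∞ χ := hχdef ▸ b.contDiff
  have hχc : HasCompactSupport χ := hχdef ▸ b.hasCompactSupport
  have hχR : tsupport χ = Metric.closedBall x₀ R := by rw [hχdef]; exact b.tsupport_eq
  have hχΩ : tsupport χ ⊆ Ω := hχR ▸ hball
  have hχ0' : ∀ x, 0 ≤ χ x := fun x => by rw [hχdef]; exact b.nonneg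
  have hloc : ∀ x ∈ Metric.ball x₀ r, χ =ᶠ[𝓝 x] 1 := fun x hx => by
    filter_upwards [Metric.isOpen_ball.mem_nhds hx] with y hy
    rw [hχdef]
    exact b.one_of_mem_closedBall (Metric.ball_subset_closedBall hy)
  -- On the annulus `φ ≤ v`, and beyond it `χ = 0`; the competitor thus differs from `v` only inside
  -- the ball where `χ = 1`.
  have hin : ∀ x, 0 < χ x * (φ x - v x) → x ∈ Metric.ball x₀ r := by
    intro x hx
    by_contra hxr
    rw [Metric.mem_ball, not_lt] at hxr
    by_cases hxR : x ∈ Metric.closedBall x₀ R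
    · exact absurd hx (not_lt.2 (mul_nonpos_of_nonneg_of_nonpos (hχ0' x)
        (sub_nonpos.2 (hann x hxR hxr))))
    · have hz : χ x = 0 := image_eq_zero_of_notMem_tsupport fun h => hxR (hχR ▸ h)
      rw [hz, zero_mul] at hx
      exact lt_irrefl _ hx
  have hone : ∀ x, 0 < χ x * (φ x - v x) → χ =ᶠ[𝓝 x] 1 := fun x hx => hloc x (hin x hx)
  have hp1 : 1 ≤ p := by linarith
  have hp1' : (1 : ℝ≥0∞) ≤ ENNReal.ofReal p := by simpa using hp1
  have : IsFiniteMeasure (volume.restrict Ω) := ⟨by simpa using hΩf.lt_top⟩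
  have hv : ContinuousOn v Ω := hA.continuousOn.mono subset_closure
  have hΦ : ContDiff ℝ 2 fun y => χ y * φ y :=
    contDiff_mul_of_tsupport_subset hΩ (mod_cast contDiff_infty.1 hχ 2) hχΩ hφ
  have hΦc : HasCompactSupport fun y => χ y * φ y := hχc.mul_right
  have hχ0 : ∀ x ∉ Ω, χ x = 0 := fun x hx => image_eq_zero_of_notMem_tsupport fun h => hx (hχΩ h)
  have hu : Continuous fun x => χ x * (φ x - v x) :=
    continuous_mul_of_tsupport_subset hΩ hχ.continuous hχΩ (hφ.continuousOn.sub hv)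
  have huc : HasCompactSupport fun x => χ x * (φ x - v x) := hχc.mul_right
  have hB := hA.add_truncPos hΩ hΩf hp1 hχ hχc hχΩ hφ hone
  have hcut := hA.sobolev.truncPos_cutoff hΩ hΩf hp1 hv hχ hχc hχΩ hφ hone
  have hle := hmin _ _ hB
  have henergy : ∀ {w H}, IsAdmissible Ω f p w H →
      IntegrableOn (fun x => 1 / p * ‖H x‖ ^ p - c * w x) Ω := by
    intro w H hw
    have h1 := hw.sobolev.memLp_grad.integrable_norm_rpow (by simp; linarith)
      ENNReal.ofReal_ne_top
    rw [ENNReal.toReal_ofReal (by linarith)] at h1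
    exact (h1.const_mul _).sub ((hw.sobolev.memLp.integrable hp1').const_mul _)
  generalize hΦdef : (fun y => χ y * φ y) = Φ at *
  generalize hudef : (fun x => χ x * (φ x - v x)) = u at *
  have hux : ∀ x, χ x * (φ x - v x) = u x := fun x => congrFun hudef x
  simp only [hux] at hin hone hB hcut hle
  have hhu : Continuous fun x => truncPosPrimitive (u x) := continuous_truncPosPrimitive.comp hu
  have hhuc : HasCompactSupport fun x => truncPosPrimitive (u x) :=
    huc.comp_left (truncPosPrimitive_of_nonpos le_rfl)
  have hu0 : ∀ x ∉ Ω, u x = 0 := fun x hx => by rw [← hux, hχ0 x hx, zero_mul]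
  let e := EuclideanSpace.basisFun (Fin n) ℝ
  have hterm : ∀ i, Integrable fun x =>
      truncPos (u x) * inner ℝ (gradient Φ x - G x) (e i) * pFlux p Φ i x := by
    intro i
    obtain ⟨C, hC⟩ := (hasCompactSupport_pFlux (p := p) hΦc i).exists_bound_of_continuous
      (contDiff_pFlux hp hΦ i).continuous
    simp only [mul_comm _ (pFlux _ _ _ _)]
    exact (hcut (e i)).1.bdd_mul (contDiff_pFlux hp hΦ i).continuous.aestronglyMeasurable
      (Eventually.of_forall hC)
  have hdiv : ∀ i, Integrable fun x => truncPosPrimitive (u x) * fderiv ℝ (pFlux p Φ i) x (e i) :=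
    fun i => (hhu.mul (((contDiff_pFlux hp hΦ i).continuous_fderiv one_ne_zero).clm_apply
      continuous_const)).integrable_of_hasCompactSupport hhuc.mul_right
  have hsum : ∀ x, ∑ i, truncPos (u x) * inner ℝ (gradient Φ x - G x) (e i) * pFlux p Φ i x
      = truncPos (u x) * (‖gradient Φ x‖ ^ (p - 2)
        * inner ℝ (gradient Φ x) (gradient Φ x - G x)) := by
    intro x
    rw [← e.sum_inner_mul_inner (gradient Φ x), Finset.mul_sum, Finset.mul_sum]
    refine Finset.sum_congr rfl fun i _ => ?_
    rw [pFlux, real_inner_comm (e i) (gradient Φ x - G x)]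
    ring
  have hsum' : ∀ x, ∑ i, truncPosPrimitive (u x) * fderiv ℝ (pFlux p Φ i) x (e i)
      = truncPosPrimitive (u x) * pLaplacian p Φ x := fun x => by
    rw [← Finset.mul_sum, sum_fderiv_pFlux hp hΦ]
  -- The weak derivative of `H(u)` tested, component by component, with the flux of `Φ`. This is why
  -- the chain rule was proved for `C¹` test functions and not just smooth ones.
  have hflux : ∫ x, truncPos (u x) * (‖gradient Φ x‖ ^ (p - 2)
        * inner ℝ (gradient Φ x) (gradient Φ x - G x))
      = -∫ x, truncPosPrimitive (u x) * pLaplacian p Φ x := by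
    simp only [← hsum, ← hsum']
    rw [integral_finsetSum _ fun i _ => hterm i, integral_finsetSum _ fun i _ => hdiv i,
      ← Finset.sum_neg_distrib]
    refine Finset.sum_congr rfl fun i _ => ?_
    rw [(hcut (e i)).2 _ (contDiff_pFlux hp hΦ i) (hasCompactSupport_pFlux hΦc i), neg_neg]
  have hfi : Integrable fun x => truncPos (u x) * (‖gradient Φ x‖ ^ (p - 2)
        * inner ℝ (gradient Φ x) (gradient Φ x - G x)) := by
    simp only [← hsum]
    exact integrable_finsetSum _ fun i _ => hterm i
  have hci : Integrable fun x => c * truncPosPrimitive (u x) :=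
    (hhu.integrable_of_hasCompactSupport hhuc).const_mul c
  have hpc : Continuous fun x => truncPosPrimitive (u x) * (pLaplacian p Φ x + c) := by
    refine hhu.mul (Continuous.add ?_ continuous_const)
    rw [← funext (sum_fderiv_pFlux hp hΦ)]
    exact continuous_finsetSum _ fun i _ =>
      ((contDiff_pFlux hp hΦ i).continuous_fderiv one_ne_zero).clm_apply continuous_const
  have hdi : Integrable fun x => truncPosPrimitive (u x) * pLaplacian p Φ x := by
    simp only [← hsum']
    exact integrable_finsetSum _ fun i _ => hdiv i
  -- Minimality makes the energy change nonnegative, and the convexity inequality with `t = truncPos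
  -- u` bounds it pointwise by this integrand.
  have hnonneg : 0 ≤ ∫ x in Ω, (truncPos (u x) * (‖gradient Φ x‖ ^ (p - 2)
        * inner ℝ (gradient Φ x) (gradient Φ x - G x)) - c * truncPosPrimitive (u x)) := by
    refine (sub_nonneg.2 hle).trans ?_
    rw [← integral_sub (henergy hB) (henergy hA)]
    refine integral_mono ((henergy hB).sub (henergy hA)) (hfi.sub hci).integrableOn fun x => ?_
    have := norm_rpow_combination_sub_le (by linarith : 2 < p) (gradient Φ x) (G x)
      (truncPos_nonneg (u x)) (truncPos_le_one (u x))
    simp only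
    linarith
  rw [setIntegral_eq_integral_of_forall_compl_eq_zero (fun x hx => by
    rw [hu0 x hx, truncPos_of_nonpos le_rfl, truncPosPrimitive_of_nonpos le_rfl]; ring),
    integral_sub hfi hci, hflux] at hnonneg
  have hposΦ : ∀ x, 0 < u x → 0 < pLaplacian p Φ x + c := by
    intro x hx
    have : Φ =ᶠ[𝓝 x] φ := by
      filter_upwards [hone x hx] with y hy
      rw [← hΦdef]; simp [hy]
    rw [pLaplacian_congr this]
    exact hpos x (hin x hx)
  have hux0 : 0 < u x₀ := by
    rw [← hux, (hloc x₀ (Metric.mem_ball_self hr)).eq_of_nhds]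
    simpa using hx₀
  have hstrict : 0 < ∫ x, truncPosPrimitive (u x) * (pLaplacian p Φ x + c) := by
    refine hpc.integral_pos_of_hasCompactSupport_nonneg_nonzero hhuc.mul_right (x := x₀)
      (fun x => ?_) (mul_pos (truncPosPrimitive_pos hux0) (hposΦ x₀ hux0)).ne'
    rcases le_or_gt (u x) 0 with h | h
    · simp [truncPosPrimitive_of_nonpos h]
    · exact mul_nonneg (truncPosPrimitive_nonneg _) (hposΦ x h).le
  have heq : ∫ x, truncPosPrimitive (u x) * (pLaplacian p Φ x + c)
      = (∫ x, truncPosPrimitive (u x) * pLaplacian p Φ x) + ∫ x, c * truncPosPrimitive (u x) := by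
    rw [← integral_add hdi hci]
    exact integral_congr_ae (Eventually.of_forall fun x => by simp only; ring)
  linarith

end Comparison

/-! ### Large-`p` asymptotics and passage to the limit -/

section Limit

variable {n : ℕ} {Ω : Set (EuclideanSpace ℝ (Fin n))} {φ ψ f vInf : EuclideanSpace ℝ (Fin n) → ℝ}
  {x₀ : EuclideanSpace ℝ (Fin n)} {ε : ℝ}

lemma continuousAt_gradient (hφ : ContDiffAt ℝ 2 φ x₀) : ContinuousAt (gradient φ) x₀ :=
  (InnerProductSpace.toDual ℝ (EuclideanSpace ℝ (Fin n))).symm.continuous.continuousAt.comp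
    (hφ.fderiv_right (m := 1) (by norm_num)).continuousAt

lemma continuousAt_fderiv_fderiv (hφ : ContDiffAt ℝ 2 φ x₀) :
    ContinuousAt (fderiv ℝ (fderiv ℝ φ)) x₀ :=
  ((hφ.fderiv_right (m := 1) (by norm_num)).fderiv_right (m := 0) (by norm_num)).continuousAt

lemma continuousAt_infLaplacian (hφ : ContDiffAt ℝ 2 φ x₀) :
    ContinuousAt (infLaplacian φ) x₀ :=
  ((continuousAt_fderiv_fderiv hφ).clm_apply (continuousAt_gradient hφ)).clm_apply
    (continuousAt_gradient hφ)

lemma continuousAt_hessianTrace (hφ : ContDiffAt ℝ 2 φ x₀) :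
    ContinuousAt (hessianTrace φ) x₀ :=
  tendsto_finsetSum _ fun _ _ => ((continuousAt_fderiv_fderiv hφ).clm_apply
    continuousAt_const).clm_apply continuousAt_const

lemma pLaplacian_add_const (p c : ℝ) (x : EuclideanSpace ℝ (Fin n)) :
    pLaplacian p (fun y => φ y + c) x = pLaplacian p φ x := by
  have h : fderiv ℝ (fun y => φ y + c) = fderiv ℝ φ := funext fun y => fderiv_add_const c
  simp only [pLaplacian, hessianTrace, infLaplacian, gradient, h]

lemma gradient_fun_neg (x : EuclideanSpace ℝ (Fin n)) :
    gradient (fun y => -φ y) x = -gradient φ x := by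
  have h : fderiv ℝ (fun y => -φ y) x = -fderiv ℝ φ x := fderiv_neg
  rw [gradient, gradient, h, map_neg]

lemma infLaplacian_neg (x : EuclideanSpace ℝ (Fin n)) :
    infLaplacian (fun y => -φ y) x = -infLaplacian φ x := by
  have h : fderiv ℝ (fun y => -φ y) = fun y => -fderiv ℝ φ y := funext fun y => fderiv_neg
  have h2 : fderiv ℝ (fun y => -fderiv ℝ φ y) x = -fderiv ℝ (fderiv ℝ φ) x := fderiv_neg
  rw [infLaplacian, infLaplacian, gradient_fun_neg, h, h2]
  simp

/-- Near a point where `Δ_∞ φ > 0` and `|∇φ| > ε`, one has `Δ_p φ > ε^{p-1}` for large `p`. -/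
lemma eventually_rpow_lt_pLaplacian (hφ : ContDiffAt ℝ 2 φ x₀) (hε : 0 ≤ ε)
    (hg : ε < ‖gradient φ x₀‖) (hI : 0 < infLaplacian φ x₀) :
    ∃ δ > 0, ∀ᶠ p : ℝ in atTop, ∀ x ∈ Metric.ball x₀ δ, ε ^ (p - 1) < pLaplacian p φ x := by
  have cg := (continuousAt_gradient hφ).norm
  have cH := (cg.pow 2).mul (continuousAt_hessianTrace hφ)
  obtain ⟨κ, hκ0, hκ⟩ := exists_between hI
  obtain ⟨C, hC⟩ := exists_lt (‖gradient φ x₀‖ ^ 2 * hessianTrace φ x₀)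
  obtain ⟨δ, hδ, hball⟩ := Metric.eventually_nhds_iff_ball.1
    ((cg.eventually (lt_mem_nhds hg)).and
      (((continuousAt_infLaplacian hφ).eventually (lt_mem_nhds hκ)).and
        (cH.eventually (lt_mem_nhds hC))))
  refine ⟨δ, hδ, ?_⟩
  have hlin : Tendsto (fun p : ℝ => (p - 2) * κ + C) atTop atTop :=
    tendsto_atTop_add_const_right _ _
      ((tendsto_atTop_add_const_right _ (-2) tendsto_id).atTop_mul_const hκ0)
  filter_upwards [eventually_gt_atTop 4, hlin.eventually_gt_atTop (ε ^ 3)] with p hp hpε x hx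
  obtain ⟨h1, h2, h3⟩ := hball x hx
  set a := ‖gradient φ x‖ with ha
  have ha0 : 0 < a := hε.trans_lt h1
  -- Factor out the power `p - 4` on both sides: `ε^{p-4} ≤ a^{p-4}`, while the remaining bracket
  -- grows linearly in `p` and so exceeds the fixed number `ε ^ 3`.
  have e1 : a ^ (p - 2) = a ^ (p - 4) * a ^ 2 := by
    rw [← Real.rpow_natCast, ← Real.rpow_add ha0]; congr 1; push_cast; ring
  have e2 : ε ^ (p - 1) = ε ^ (p - 4) * ε ^ 3 := by
    rw [← Real.rpow_natCast, ← Real.rpow_add_of_nonneg hε (by linarith) (by positivity)]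
    congr 1; push_cast; ring
  have e3 : pLaplacian p φ x
      = a ^ (p - 4) * (a ^ 2 * hessianTrace φ x + (p - 2) * infLaplacian φ x) := by
    rw [pLaplacian, ← ha, e1]; ring
  rw [e2, e3]
  have h4 : ε ^ 3 < a ^ 2 * hessianTrace φ x + (p - 2) * infLaplacian φ x := by
    have h5 : C < a ^ 2 * hessianTrace φ x := h3
    have : (p - 2) * κ ≤ (p - 2) * infLaplacian φ x :=
      mul_le_mul_of_nonneg_left h2.le (by linarith)
    linarith
  calc ε ^ (p - 4) * ε ^ 3 ≤ a ^ (p - 4) * ε ^ 3 :=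
        mul_le_mul_of_nonneg_right (Real.rpow_le_rpow hε h1.le (by linarith)) (by positivity)
    _ < _ := mul_lt_mul_of_pos_left h4 (Real.rpow_pos_of_pos ha0 _)

/-- Exponential decay beats linear growth. It is applied with `b` the ratio of a local gradient
bound to `ε`. -/
lemma tendsto_rpow_mul_affine {b : ℝ} (hb0 : 0 < b) (hb1 : b < 1) (A B : ℝ) :
    Tendsto (fun s : ℝ => b ^ s * (A + s * B)) atTop (𝓝 0) := by
  have h1 : Tendsto (fun s : ℝ => b ^ s) atTop (𝓝 0) :=
    tendsto_rpow_atTop_of_base_lt_one b (by linarith) hb1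
  have h2 := tendsto_rpow_mul_exp_neg_mul_atTop_nhds_zero 1 (-Real.log b)
    (neg_pos.2 (Real.log_neg hb0 hb1))
  have h3 := (h1.mul_const A).add (h2.mul_const B)
  simp only [zero_mul, add_zero] at h3
  refine h3.congr fun s => ?_
  rw [neg_neg, ← Real.rpow_def_of_pos hb0, Real.rpow_one]
  ring

/-- Near a point where `|∇φ| < ε`, one has `Δ_p φ > -ε^{p-1}` for large `p`. -/
lemma eventually_neg_rpow_lt_pLaplacian (hφ : ContDiffAt ℝ 2 φ x₀)
    (hg : ‖gradient φ x₀‖ < ε) :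
    ∃ δ > 0, ∀ᶠ p : ℝ in atTop, ∀ x ∈ Metric.ball x₀ δ,
      0 < pLaplacian p φ x + ε ^ (p - 1) := by
  -- The intermediate value bounds `|∇φ|` on a whole ball while keeping the ratio `a / ε` strictly
  -- below `1`.
  obtain ⟨a, ha, haε⟩ := exists_between hg
  have ha0 : 0 < a := (norm_nonneg _).trans_lt ha
  have hε0 : 0 < ε := ha0.trans haε
  obtain ⟨A, hA⟩ := exists_gt ‖hessianTrace φ x₀‖
  obtain ⟨B, hB⟩ := exists_gt ‖fderiv ℝ (fderiv ℝ φ) x₀‖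
  have cD : ContinuousAt (fun x => ‖fderiv ℝ (fderiv ℝ φ) x‖) x₀ :=
    (continuous_norm (E := EuclideanSpace ℝ (Fin n) →L[ℝ] EuclideanSpace ℝ (Fin n) →L[ℝ] ℝ)
      ).continuousAt.comp (continuousAt_fderiv_fderiv hφ)
  obtain ⟨δ, hδ, hball⟩ := Metric.eventually_nhds_iff_ball.1
    (((continuousAt_gradient hφ).norm.eventually (gt_mem_nhds ha)).and
      (((continuousAt_hessianTrace hφ).norm.eventually (gt_mem_nhds hA)).and
        (cD.eventually (gt_mem_nhds hB))))
  refine ⟨δ, hδ, ?_⟩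
  have hlim := (tendsto_rpow_mul_affine (div_pos ha0 hε0) ((div_lt_one hε0).2 haε) A B).comp
    (tendsto_atTop_add_const_right atTop (-2 : ℝ) tendsto_id)
  filter_upwards [eventually_gt_atTop 4, hlim.eventually (gt_mem_nhds hε0)] with p hp hpε x hx
  obtain ⟨h1, h2, h3⟩ := hball x hx
  simp only [Function.comp_apply, id_eq, ← sub_eq_add_neg] at hpε
  set g := ‖gradient φ x‖ with hgdef
  have hg0 : 0 ≤ g := norm_nonneg _
  have e1 : g ^ (p - 4) * g ^ 2 = g ^ (p - 2) := by
    rw [← Real.rpow_natCast, ← Real.rpow_add_of_nonneg hg0 (by linarith) (by positivity)]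
    congr 1; push_cast; ring
  have hI : ‖infLaplacian φ x‖ ≤ B * g ^ 2 := by
    have := ContinuousLinearMap.le_opNorm₂ (fderiv ℝ (fderiv ℝ φ) x) (gradient φ x) (gradient φ x)
    calc ‖infLaplacian φ x‖ ≤ ‖fderiv ℝ (fderiv ℝ φ) x‖ * g * g := this
      _ = ‖fderiv ℝ (fderiv ℝ φ) x‖ * g ^ 2 := by ring
      _ ≤ _ := mul_le_mul_of_nonneg_right h3.le (by positivity)
  have hA0 : 0 ≤ A := (norm_nonneg _).trans hA.le
  have hB0 : 0 ≤ B := (ContinuousLinearMap.opNorm_nonneg _).trans hB.le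
  -- Since `|Δ_∞ φ| ≤ B |∇φ|²`, both terms of the `p`-Laplacian carry the factor `|∇φ|^{p-2}`,
  -- including at critical points; monotonicity then replaces it by `a^{p-2}`.
  have hbound : -(a ^ (p - 2) * (A + (p - 2) * B)) ≤ pLaplacian p φ x := by
    have t1 : -(g ^ (p - 2) * A) ≤ g ^ (p - 2) * hessianTrace φ x := by
      rw [← mul_neg]
      exact mul_le_mul_of_nonneg_left (neg_le_of_abs_le h2.le) (by positivity)
    have t2 : -((p - 2) * g ^ (p - 2) * B) ≤ (p - 2) * g ^ (p - 4) * infLaplacian φ x := by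
      rw [← e1]
      have := mul_le_mul_of_nonneg_left (neg_le_of_abs_le hI)
        (mul_nonneg (by linarith : 0 ≤ p - 2) (by positivity : 0 ≤ g ^ (p - 4)))
      linarith
    have t3 : g ^ (p - 2) * (A + (p - 2) * B) ≤ a ^ (p - 2) * (A + (p - 2) * B) :=
      mul_le_mul_of_nonneg_right (Real.rpow_le_rpow hg0 h1.le (by linarith))
        (add_nonneg hA0 (mul_nonneg (by linarith) hB0))
    rw [pLaplacian, ← hgdef]
    linarith
  have hlt : a ^ (p - 2) * (A + (p - 2) * B) < ε ^ (p - 1) := by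
    have e2 : ε ^ (p - 1) = ε ^ (p - 2) * ε := by
      rw [← Real.rpow_add_one hε0.ne']; congr 1; ring
    rw [Real.div_rpow ha0.le hε0.le, div_mul_eq_mul_div, div_lt_iff₀ (by positivity)] at hpε
    rw [e2]; linarith
  linarith

/-- If minimizers converge uniformly to `vInf` and `φ` touches `vInf` from below, then `φ` is not a
strict subsolution of the Euler-Lagrange equations near the contact point. -/
theorem not_eventually_strict_subsolution {p c : ℕ → ℝ} (hΩ : IsOpen Ω) (hΩf : volume Ω ≠ ⊤)
    (hp : Tendsto p atTop atTop) {v : ℕ → EuclideanSpace ℝ (Fin n) → ℝ}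
    (hv : ∀ j, ∃ G, IsAdmissible Ω f (p j) (v j) G ∧ ∀ w H, IsAdmissible Ω f (p j) w H →
      ∫ x in Ω, (1 / p j * ‖G x‖ ^ p j - c j * v j x)
        ≤ ∫ x in Ω, (1 / p j * ‖H x‖ ^ p j - c j * w x))
    (hlim : TendstoUniformlyOn v vInf atTop (closure Ω)) (hcont : ContinuousOn vInf Ω)
    (hφ : TouchesFromBelow Ω φ vInf x₀) {δ : ℝ} (hδ : 0 < δ) :
    ¬ ∀ᶠ j in atTop, ∀ x ∈ Metric.ball x₀ δ, 0 < pLaplacian (p j) φ x + c j := by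
  intro hpos
  obtain ⟨R₀, hR₀, hR₀Ω⟩ := Metric.nhds_basis_closedBall.mem_iff.1 (hΩ.mem_nhds hφ.mem)
  set R := min R₀ δ with hR
  have hR0 : 0 < R := lt_min hR₀ hδ
  have hball : Metric.closedBall x₀ R ⊆ Ω :=
    (Metric.closedBall_subset_closedBall (min_le_left _ _)).trans hR₀Ω
  have hK : IsCompact (Metric.closedBall x₀ R \ Metric.ball x₀ (R / 2)) :=
    (isCompact_closedBall x₀ R).diff Metric.isOpen_ball
  -- `m` is a positive gap between `vInf` and `φ` on the annulus. Raising `φ` by `m / 2` and taking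
  -- `v j` within `m / 4` of `vInf` puts the raised function above `v j` at `x₀` and below it on the
  -- annulus.
  obtain ⟨m, hm0, hm⟩ := hK.exists_forall_le' (f := fun x => vInf x - φ x) (a := 0)
    ((hcont.sub hφ.contDiffOn.continuousOn).mono (sdiff_subset.trans hball)) (by
      intro x hx
      refine sub_pos.2 (hφ.lt x (hball hx.1) ?_)
      rintro rfl
      exact hx.2 (Metric.mem_ball_self (by linarith)))
  obtain ⟨j, hj, hj4, hju⟩ := (hpos.and ((hp.eventually_gt_atTop 4).and
    (Metric.tendstoUniformlyOn_iff.1 hlim (m / 4) (by linarith)))).exists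
  obtain ⟨G, hA, hmin⟩ := hv j
  have hclose : ∀ x ∈ Ω, |vInf x - v j x| < m / 4 := fun x hx => by
    have := hju x (subset_closure hx)
    rwa [Real.dist_eq] at this
  refine hA.false_of_touching hΩ hΩf hj4 hmin (φ := fun x => φ x + m / 2)
    (hφ.contDiffOn.add contDiffOn_const) (half_pos hR0) (half_lt_self hR0) hball ?_ ?_ ?_
  · have h1 := abs_lt.1 (hclose x₀ hφ.mem)
    have h2 := hφ.eq
    linarith
  · intro x hx hxr
    have h1 := abs_lt.1 (hclose x (hball hx))
    have h2 := hm x ⟨hx, fun h => (Metric.mem_ball.1 h).not_ge hxr⟩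
    linarith
  · intro x hx
    rw [pLaplacian_add_const]
    exact hj x (Metric.ball_subset_ball ((half_le_self hR0.le).trans (min_le_right _ _)) hx)

/-- Reflection `v ↦ -v` carries touching from above to touching from below. -/
lemma InfinityLaplace.IsAdmissible.neg {p : ℝ} {v : EuclideanSpace ℝ (Fin n) → ℝ}
    {G : EuclideanSpace ℝ (Fin n) → EuclideanSpace ℝ (Fin n)} (h : IsAdmissible Ω f p v G) :
    IsAdmissible Ω (fun x => -f x) p (fun x => -v x) (fun x => -G x) := by
  refine ⟨h.continuousOn.neg, fun x hx => congrArg Neg.neg (h.boundary x hx), h.sobolev.memLp.neg,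
    h.sobolev.memLp_grad.neg, fun η h1 h2 h3 e => ?_⟩
  simp only [neg_mul, inner_neg_left, integral_neg, h.sobolev.integral_eq η h1 h2 h3 e]

end Limit

/-! ### The viscosity inequalities for the limit -/

theorem mainTheorem4 (n : ℕ) (hn : 1 ≤ n)
    (Ω : Set (EuclideanSpace ℝ (Fin n))) (hΩo : IsOpen Ω) (hΩc : IsConnected Ω)
    (hΩb : Bornology.IsBounded Ω)
    (f : EuclideanSpace ℝ (Fin n) → ℝ) (L : ℝ≥0) (hf : LipschitzOnWith L f (closure Ω))
    (ε : ℝ) (hε : 0 ≤ ε)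
    (p : ℕ → ℝ) (hpn : ∀ j, (n : ℝ) < p j) (hp : Tendsto p atTop atTop)
    (v : ℕ → EuclideanSpace ℝ (Fin n) → ℝ) (hv : ∀ j, IsMinimizer Ω f (p j) ε (v j))
    (vInf : EuclideanSpace ℝ (Fin n) → ℝ)
    (hlim : TendstoUniformlyOn v vInf atTop (closure Ω)) :
    IsViscositySolution (fun φ x => max (ε - ‖gradient φ x‖) (infLaplacian φ x)) Ω vInf ∧
    (∀ φ x₀, TouchesFromBelow Ω φ vInf x₀ →
      ε ≤ ‖gradient φ x₀‖ ∧ infLaplacian φ x₀ ≤ 0) ∧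
    (∀ ψ x₀, TouchesFromAbove Ω ψ vInf x₀ →
      ‖gradient ψ x₀‖ ≤ ε ∨ 0 ≤ infLaplacian ψ x₀) ∧
    (ε = 0 → IsViscositySolution infLaplacian Ω vInf) := by
  have hΩf : volume Ω ≠ ⊤ := hΩb.measure_lt_top.ne
  have hcont : ContinuousOn vInf Ω := by
    refine (hlim.continuousOn (Eventually.of_forall fun j => ?_).frequently).mono subset_closure
    obtain ⟨G, hG, -⟩ := hv j
    exact hG.continuousOn
  -- The gradient term is even and the linear term is odd, so `-v j` minimizes the functional with
  -- the opposite constant `-ε^{p-1}`.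
  have hneg : ∀ j, ∃ G, IsAdmissible Ω (fun x => -f x) (p j) (fun x => -v j x) G ∧
      ∀ w H, IsAdmissible Ω (fun x => -f x) (p j) w H →
        ∫ x in Ω, (1 / p j * ‖G x‖ ^ p j - (-ε ^ (p j - 1)) * -v j x)
          ≤ ∫ x in Ω, (1 / p j * ‖H x‖ ^ p j - (-ε ^ (p j - 1)) * w x) := by
    intro j
    obtain ⟨G, hG, hmin⟩ := hv j
    refine ⟨fun x => -G x, hG.neg, fun w H hw => ?_⟩
    have hw' := hw.neg
    simp only [neg_neg] at hw'
    have := hmin _ _ hw'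
    simpa only [energy, norm_neg, neg_mul_neg, mul_neg, neg_mul, neg_neg] using this
  have below : ∀ φ x₀, TouchesFromBelow Ω φ vInf x₀ →
      ε ≤ ‖gradient φ x₀‖ ∧ infLaplacian φ x₀ ≤ 0 := by
    intro φ x₀ hφ
    have hφ2 : ContDiffAt ℝ 2 φ x₀ := hφ.contDiffOn.contDiffAt (hΩo.mem_nhds hφ.mem)
    constructor
    · by_contra! hlt
      obtain ⟨δ, hδ, h⟩ := eventually_neg_rpow_lt_pLaplacian hφ2 hlt
      exact not_eventually_strict_subsolution hΩo hΩf hp hv hlim hcont hφ hδ (hp.eventually h)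
    · by_contra! hlt
      have hg : 0 < ‖gradient φ x₀‖ := by
        refine norm_pos_iff.2 fun h0 => ?_
        simp [infLaplacian, h0] at hlt
      -- The threshold is `0` here, not `ε`: `Δ_p φ > 0` suffices because the constant `ε^{p-1}` is
      -- nonnegative.
      obtain ⟨δ, hδ, h⟩ := eventually_rpow_lt_pLaplacian hφ2 le_rfl hg hlt
      refine not_eventually_strict_subsolution hΩo hΩf hp hv hlim hcont hφ hδ
        ((hp.eventually h).mono fun j hj x hx => ?_)
      exact add_pos_of_pos_of_nonneg ((Real.rpow_nonneg le_rfl _).trans_lt (hj x hx))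
        (Real.rpow_nonneg hε _)
  have above : ∀ ψ x₀, TouchesFromAbove Ω ψ vInf x₀ →
      ‖gradient ψ x₀‖ ≤ ε ∨ 0 ≤ infLaplacian ψ x₀ := by
    intro ψ x₀ hψ
    by_contra! hlt
    have hφ : TouchesFromBelow Ω (fun x => -ψ x) (fun x => -vInf x) x₀ :=
      ⟨hψ.mem, hψ.contDiffOn.neg, congrArg Neg.neg hψ.eq,
        fun x hx hne => neg_lt_neg (hψ.lt x hx hne)⟩
    have hlim' : TendstoUniformlyOn (fun j x => -v j x) (fun x => -vInf x) atTop (closure Ω) :=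
      hlim.neg
    obtain ⟨δ, hδ, h⟩ := eventually_rpow_lt_pLaplacian
      (hφ.contDiffOn.contDiffAt (hΩo.mem_nhds hφ.mem)) hε
      (by rw [gradient_fun_neg, norm_neg]; exact hlt.1)
      (by rw [infLaplacian_neg]; exact neg_pos.2 hlt.2)
    refine not_eventually_strict_subsolution hΩo hΩf hp hneg hlim' hcont.neg hφ hδ
      ((hp.eventually h).mono fun j hj x hx => ?_)
    have := hj x hx
    linarith
  refine ⟨⟨⟨hcont, fun φ x₀ hφ => ?_⟩, ⟨hcont, fun ψ x₀ hψ => ?_⟩⟩, below, above, fun h0 =>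
    ⟨⟨hcont, fun φ x₀ hφ => (below φ x₀ hφ).2⟩, ⟨hcont, fun ψ x₀ hψ => ?_⟩⟩⟩
  · exact max_le (sub_nonpos.2 (below φ x₀ hφ).1) (below φ x₀ hφ).2
  · rcases above ψ x₀ hψ with h | h
    · exact le_max_of_le_left (sub_nonneg.2 h)
    · exact le_max_of_le_right h
  -- For `ε = 0` the first alternative forces `∇ψ(x₀) = 0`, and then `Δ_∞ ψ(x₀) = 0`.
  · rcases above ψ x₀ hψ with h | h
    · have hz : gradient ψ x₀ = 0 := norm_le_zero_iff.1 (h0 ▸ h)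
      simp [infLaplacian, hz]
    · exact h
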